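/- Let $q > 2$ be an integer and let $\mathbb{U} = (U, \mathcal{B})$ be a unital of order $q$, i.e. a $2$-$(q^3+1,\, q+1,\, 1)$ design: it has $q^3+1$ points, every block is incident with exactly $q+1$ points, and any two different points are incident with exactly one common block. Let $\mathcal{C}$ be a set of mutually intersecting blocks of $\mathbb{U}$; i.e., $\mathcal{C}$ is a clique in the confluence graph of $\mathbb{U}$, the graph whose vertices are the blocks and in which two different blocks are adjacent if and only if they are incident with a common point. Then $|\mathcal{C}| \le q^2$, and $|\mathcal{C}| = q^2$ if and only if $\mathcal{C}$ is the pencil of all blocks through some point of $\mathbb{U}$. -/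

import Mathlib

/-- A `2`-`(v, k, l)` design, as an incidence geometry with point set `P`, block set `B` and
incidence relation `I`: there are `v` points, every block is incident with exactly `k` points, and
any two different points are incident with exactly `l` common blocks. -/
structure IsTwoDesign {P B : Type*} (I : P → B → Prop) (v k l : ℕ) : Prop where
  card_points : ENat.card P = v
  card_pointRow : ∀ b : B, {p : P | I p b}.encard = k
  card_joining : ∀ p r : P, p ≠ r → {b : B | I p b ∧ I r b}.encard = l

/-- A unital of order `q > 1` is a `2`-`(q ^ 3 + 1, q + 1, 1)` design. -/
structure IsUnital {P B : Type*} (I : P → B → Prop) (q : ℕ) : Prop where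
  one_lt : 1 < q
  isTwoDesign : IsTwoDesign I (q ^ 3 + 1) (q + 1) 1

/-- The confluence graph of an incidence geometry: its vertices are the blocks, and two different
blocks are adjacent if they are incident with a common point. -/
def confluenceGraph {P B : Type*} (I : P → B → Prop) : SimpleGraph B where
  Adj b c := b ≠ c ∧ ∃ p : P, I p b ∧ I p c
  symm := ⟨fun _ _ h => ⟨h.1.symm, h.2.imp fun _ hp => hp.symm⟩⟩
  loopless := ⟨fun _ h => h.1 rfl⟩

/-- The pencil of a point: the set of all blocks incident with it. -/
def pencil {P B : Type*} (I : P → B → Prop) (p : P) : Set B :=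
  {b : B | I p b}

section

open Finset
open scoped Classical

variable {P B : Type*} {I : P → B → Prop} {q : ℕ}

/-! A pencil has `q ^ 2` blocks, so it suffices that a clique without a common point has fewer
(`card_lt_of_no_common_point`). Otherwise take `q ^ 2` of its blocks, covering a point set `S`.
Every point lies on at most `q + 1` of them; `#S` is `q ^ 2 + q + 1` if this bound is attained and
`q ^ 2 + q` if not. Both values violate `support_inequality`: so small a set cannot contain that
many full blocks. -/

theorem Finset.sum_card_filter_comm {α β : Type*} (R : α → β → Prop) (s : Finset α)
    (t : Finset β) : ∑ b ∈ t, #{x ∈ s | R x b} = ∑ x ∈ s, #{b ∈ t | R x b} :=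
  (sum_card_bipartiteAbove_eq_sum_card_bipartiteBelow R).symm

theorem IsUnital.finite_points (hU : IsUnital I q) : Finite P := by
  have h := hU.isTwoDesign.card_points
  rw [← ENat.card_lt_top, h]
  exact_mod_cast ENat.natCast_lt_top (q ^ 3 + 1)

theorem IsUnital.existsUnique_block (hU : IsUnital I q) {p r : P} (h : p ≠ r) :
    ∃ b, {c | I p c ∧ I r c} = {b} :=
  Set.encard_eq_one.1 (by simpa using hU.isTwoDesign.card_joining p r h)

theorem IsUnital.block_unique (hU : IsUnital I q) {p r : P} (h : p ≠ r) {b c : B}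
    (hpb : I p b) (hrb : I r b) (hpc : I p c) (hrc : I r c) : b = c := by
  obtain ⟨a, ha⟩ := hU.existsUnique_block h
  have hb : b ∈ ({a} : Set B) := ha ▸ ⟨hpb, hrb⟩
  have hc : c ∈ ({a} : Set B) := ha ▸ ⟨hpc, hrc⟩
  exact hb.trans hc.symm

theorem IsUnital.finite_blocks (hU : IsUnital I q) : Finite B := by
  have := hU.finite_points
  have h (b : B) : ∃ x : P × P, x.1 ≠ x.2 ∧ I x.1 b ∧ I x.2 b := by
    have h1 : 1 < {p : P | I p b}.encard := by
      rw [hU.isTwoDesign.card_pointRow b]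
      have := hU.one_lt
      exact_mod_cast (by lia : 1 < q + 1)
    obtain ⟨x, y, hx, hy, hxy⟩ := Set.one_lt_encard_iff.1 h1
    exact ⟨(x, y), hxy, hx, hy⟩
  choose f hne h1 h2 using h
  refine Finite.of_injective f fun b c hbc => ?_
  exact hU.block_unique (hne b) (h1 b) (h2 b) (hbc ▸ h1 c) (hbc ▸ h2 c)

theorem confluenceGraph_isClique_meet {C : Set B} (hC : (confluenceGraph I).IsClique C)
    {b c : B} (hb : b ∈ C) (hc : c ∈ C) (h : b ≠ c) : ∃ p, I p b ∧ I p c :=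
  (hC hb hc h).2

theorem IsUnital.card_join [Fintype B] (hU : IsUnital I q) {p r : P} (h : p ≠ r) :
    #{b | I p b ∧ I r b} = 1 := by
  have h := hU.isTwoDesign.card_joining p r h
  rw [← Finset.coe_filter_univ, Set.encard_coe_eq_coe_finsetCard] at h
  exact_mod_cast h

theorem IsUnital.sum_pairs [Fintype B] (hU : IsUnital I q) (S : Finset P) :
    ∑ b, (#{x ∈ S | I x b} : ℤ) * (#{x ∈ S | I x b} - 1) = (#S : ℤ) * (#S - 1) := by
  have h := (sum_card_filter_comm (fun (x : P × P) b => I x.1 b ∧ I x.2 b) S.offDiag univ).trans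
    (sum_congr rfl (g := fun _ => 1) fun x hx => by
      convert hU.card_join (mem_offDiag.1 hx).2.2)
  rw [sum_const, smul_eq_mul, mul_one] at h
  have hoff (T : Finset P) : (#T.offDiag : ℤ) = #T * (#T - 1) := by
    rw [offDiag_card, Nat.cast_sub (Nat.le_mul_self _)]
    push_cast
    ring
  rw [← hoff, ← h, Nat.cast_sum]
  refine sum_congr rfl fun b _ => ?_
  rw [← hoff]
  congr 2
  ext x
  simp only [mem_offDiag, mem_filter]
  tauto

variable [Fintype P]

theorem IsUnital.card_points (hU : IsUnital I q) : Fintype.card P = q ^ 3 + 1 := by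
  have h := hU.isTwoDesign.card_points
  rw [ENat.card_eq_coe_fintype_card] at h
  exact_mod_cast h

theorem IsUnital.card_row (hU : IsUnital I q) (b : B) : #{p | I p b} = q + 1 := by
  have h := hU.isTwoDesign.card_pointRow b
  rw [← Finset.coe_filter_univ, Set.encard_coe_eq_coe_finsetCard] at h
  exact_mod_cast h

theorem IsUnital.card_meet_le (hU : IsUnital I q) {b c : B} (h : b ≠ c) :
    #{p | I p b ∧ I p c} ≤ 1 := by
  refine card_le_one.2 fun x hx y hy => ?_
  simp only [mem_filter, mem_univ, true_and] at hx hy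
  by_contra hxy
  exact h (hU.block_unique hxy hx.1 hy.1 hx.2 hy.2)

theorem IsUnital.card_meet (hU : IsUnital I q) {C : Set B} (hC : (confluenceGraph I).IsClique C)
    {b c : B} (hb : b ∈ C) (hc : c ∈ C) (h : b ≠ c) : #{p | I p b ∧ I p c} = 1 := by
  refine le_antisymm (hU.card_meet_le h) (card_pos.2 ?_)
  obtain ⟨p, hp⟩ := confluenceGraph_isClique_meet hC hb hc h
  exact ⟨p, by simpa using hp⟩

/-! ### Degrees of points in a clique and the size of its support -/

/-- The points of a block `c` that are joined to `z ∉ c` by a block of the clique are as many as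
the blocks of the clique through `z`. -/
theorem IsUnital.card_joined (hU : IsUnital I q) {C : Finset B}
    (hC : (confluenceGraph I).IsClique (C : Set B)) {z : P} {c : B} (hc : c ∈ C) (hz : ¬ I z c) :
    #{x | I x c ∧ ∃ b ∈ C, I z b ∧ I x b} = #{b ∈ C | I z b} := by
  have hne {b : B} (hb : I z b) : b ≠ c := fun h => hz (h ▸ hb)
  symm
  have h (b : B) (hb : b ∈ ({b ∈ C | I z b} : Finset B)) : ∃ p, I p b ∧ I p c := by
    rw [mem_filter] at hb
    exact confluenceGraph_isClique_meet hC hb.1 hc (hne hb.2)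
  choose f hf using h
  refine card_bij f (fun b hb => ?_) (fun b hb b' hb' h => ?_) (fun x hx => ?_)
  · have hb' := mem_filter.1 hb
    simpa using ⟨(hf b hb).2, b, hb'.1, hb'.2, (hf b hb).1⟩
  · refine hU.block_unique (p := z) (r := f b hb) ?_ (mem_filter.1 hb).2 (hf b hb).1
      (mem_filter.1 hb').2 (h ▸ (hf b' hb').1)
    exact fun e => hz (e ▸ (hf b hb).2)
  · simp only [mem_filter, mem_univ, true_and] at hx
    obtain ⟨hxc, b, hb, hzb, hxb⟩ := hx
    have hm : b ∈ ({b ∈ C | I z b} : Finset B) := mem_filter.2 ⟨hb, hzb⟩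
    refine ⟨b, hm, ?_⟩
    by_contra hxy
    exact hne hzb (hU.block_unique hxy (hf b hm).1 hxb (hf b hm).2 hxc)

theorem IsUnital.card_degree_le (hU : IsUnital I q) {C : Finset B}
    (hC : (confluenceGraph I).IsClique (C : Set B)) {z : P} {c : B} (hc : c ∈ C) (hz : ¬ I z c) :
    #{b ∈ C | I z b} ≤ q + 1 := by
  rw [← hU.card_joined hC hc hz, ← hU.card_row c]
  exact card_le_card (monotone_filter_right _ fun x _ hx => hx.1)

theorem IsUnital.sum_degree_row (hU : IsUnital I q) {C : Finset B}
    (hC : (confluenceGraph I).IsClique (C : Set B)) {c : B} (hc : c ∈ C) :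
    ∑ x with I x c, #{b ∈ C | I x b} = q + #C := by
  rw [← sum_card_filter_comm, ← add_sum_erase _ _ hc,
    sum_congr rfl (g := fun _ => 1) fun b hb => ?_, sum_const, card_erase_of_mem hc]
  · rw [filter_filter]
    simp only [and_self, hU.card_row, smul_eq_mul, mul_one]
    have := card_pos.2 ⟨c, hc⟩
    lia
  · rw [filter_filter, hU.card_meet hC hc (mem_of_mem_erase hb) (ne_of_mem_erase hb).symm]

theorem IsUnital.sum_degree (hU : IsUnital I q) (C : Finset B) :
    ∑ x, #{b ∈ C | I x b} = #C * (q + 1) := by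
  rw [← sum_card_filter_comm, sum_congr rfl fun b _ => hU.card_row b, sum_const, smul_eq_mul]

/-- If a point is on the maximal number of blocks of a clique, then it is joined to every point
covered by the clique. -/
theorem IsUnital.card_support_of_degree_eq (hU : IsUnital I q) {C : Finset B}
    (hC : (confluenceGraph I).IsClique (C : Set B)) {z : P} (hz : #{b ∈ C | I z b} = q + 1) :
    #{x | ∃ b ∈ C, I x b} = q ^ 2 + q + 1 := by
  have hjoin : ∀ x, (∃ b ∈ C, I x b) → ∃ b ∈ C, I z b ∧ I x b := by
    rintro x ⟨c, hc, hxc⟩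
    by_cases hzc : I z c
    · exact ⟨c, hc, hzc, hxc⟩
    have h : ({x | I x c ∧ ∃ b ∈ C, I z b ∧ I x b} : Finset P) = ({x | I x c} : Finset P) := by
      refine eq_of_subset_of_card_le (monotone_filter_right _ fun x _ hx => hx.1) ?_
      rw [hU.card_joined hC hc hzc, hz, hU.card_row]
    have hx : x ∈ ({x | I x c} : Finset P) := by simpa using hxc
    rw [← h] at hx
    exact (mem_filter.1 hx).2.2
  set S : Finset P := {x | ∃ b ∈ C, I x b} with hS
  have hzS : z ∈ S := by
    obtain ⟨b, hb⟩ := card_pos.1 (hz.symm ▸ Nat.succ_pos q : 0 < #{b ∈ C | I z b})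
    rw [mem_filter] at hb
    simpa [hS] using ⟨b, hb⟩
  have h := sum_card_filter_comm I (S.erase z) ({b ∈ C | I z b} : Finset B)
  have hl : ∀ b ∈ ({b ∈ C | I z b} : Finset B), #{x ∈ S.erase z | I x b} = q := by
    intro b hb
    rw [mem_filter] at hb
    have : ({x ∈ S | I x b} : Finset P) = ({x | I x b} : Finset P) := by
      ext x
      simpa [hS] using fun hx => ⟨b, hb.1, hx⟩
    rw [filter_erase, this, card_erase_of_mem (by simpa using hb.2), hU.card_row,
      Nat.add_sub_cancel]
  have hr : ∀ x ∈ S.erase z, #{b ∈ ({b ∈ C | I z b} : Finset B) | I x b} = 1 := by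
    intro x hx
    obtain ⟨b, hb, hzb, hxb⟩ := hjoin x (by simpa [hS] using mem_of_mem_erase hx)
    refine card_eq_one.2 ⟨b, eq_singleton_iff_unique_mem.2 ⟨by simp [hb, hzb, hxb], ?_⟩⟩
    intro c hc
    simp only [mem_filter] at hc
    exact hU.block_unique (ne_of_mem_erase hx) hc.2 hc.1.2 hxb hzb
  rw [sum_congr rfl hl, sum_congr rfl hr, sum_const, sum_const, hz, card_erase_of_mem hzS] at h
  have := card_pos.2 ⟨z, hzS⟩
  simp only [smul_eq_mul, mul_one] at h
  have h2 : #S = (q + 1) * q + 1 := by lia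
  rw [h2]
  ring

/-- Along a block of `C` the degrees sum to `q + q ^ 2`, so they average `q`; the bound makes each
equal to `q`. -/
theorem IsUnital.card_support_of_degree_le (hU : IsUnital I q) {C : Finset B}
    (hC : (confluenceGraph I).IsClique (C : Set B)) (hcard : #C = q ^ 2)
    (hle : ∀ x, #{b ∈ C | I x b} ≤ q) : #{x | ∃ b ∈ C, I x b} = q ^ 2 + q := by
  have hq : 0 < q := by have := hU.one_lt; lia
  have heq : ∀ x ∈ ({x | ∃ b ∈ C, I x b} : Finset P), #{b ∈ C | I x b} = q := by
    intro x hx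
    obtain ⟨c, hc, hxc⟩ := (mem_filter.1 hx).2
    have hs : ∑ x with I x c, #{b ∈ C | I x b} = ∑ x with I x c, q := by
      rw [hU.sum_degree_row hC hc, hcard, sum_const, hU.card_row, smul_eq_mul]
      ring
    exact (sum_eq_sum_iff_of_le fun x _ => hle x).1 hs x (by simpa using hxc)
  have h := hU.sum_degree C
  rw [← sum_filter_add_sum_filter_not univ (fun x => ∃ b ∈ C, I x b), sum_congr rfl heq, sum_const,
    sum_eq_zero, hcard, smul_eq_mul, add_zero] at h
  · exact Nat.eq_of_mul_eq_mul_right hq (h.trans (by ring))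
  · intro x hx
    simp only [mem_filter, mem_univ, true_and, not_exists, not_and] at hx
    exact card_eq_zero.2 (filter_eq_empty_iff.2 fun b hb => hx b hb)

/-! ### Intersections of all blocks with a point set -/

variable [Fintype B]

theorem IsUnital.card_pencil (hU : IsUnital I q) (p : P) : #{b | I p b} = q ^ 2 := by
  have hq : 0 < q := by have := hU.one_lt; lia
  have h := sum_card_filter_comm I (univ.erase p) ({b | I p b} : Finset B)
  have hl : ∀ b ∈ ({b | I p b} : Finset B), #{x ∈ univ.erase p | I x b} = q := by
    intro b hb
    rw [filter_erase, card_erase_of_mem (by simpa using hb), hU.card_row, Nat.add_sub_cancel]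
  have hr : ∀ x ∈ univ.erase p, #{b ∈ ({b | I p b} : Finset B) | I x b} = 1 := by
    intro x hx
    rw [filter_filter, hU.card_join (ne_of_mem_erase hx).symm]
  rw [sum_congr rfl hl, sum_congr rfl hr, sum_const, sum_const, card_erase_of_mem (mem_univ p),
    card_univ, hU.card_points] at h
  simp only [smul_eq_mul, mul_one, Nat.add_sub_cancel] at h
  exact Nat.eq_of_mul_eq_mul_right hq (h.trans (by ring))

/-- Counting incidences between the points outside a set `S` and blocks, weighted by the excess
of the intersections with `S`. -/
theorem IsUnital.sum_excess (hU : IsUnital I q) (S : Finset P) :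
    ∑ b, ((q : ℤ) + 1 - #{x ∈ S | I x b}) * (#{x ∈ S | I x b} - 1) =
      ((q : ℤ) ^ 3 + 1 - #S) * (#S - q ^ 2) := by
  -- The `q ^ 2` blocks through `y` partition `S`.
  have hy : ∀ y ∈ Sᶜ, ∑ b with I y b, ((#{x ∈ S | I x b} : ℤ) - 1) = #S - q ^ 2 := by
    intro y hy
    have hr : ∀ x ∈ S, #{b ∈ ({b | I y b} : Finset B) | I x b} = 1 := by
      intro x hx
      rw [filter_filter, hU.card_join]
      rintro rfl
      exact mem_compl.1 hy hx
    have h := sum_card_filter_comm I S ({b | I y b} : Finset B)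
    rw [sum_congr rfl hr, sum_const, smul_eq_mul, mul_one] at h
    rw [sum_sub_distrib, ← Nat.cast_sum, h, sum_const, hU.card_pencil]
    simp
  have h : ∑ y ∈ Sᶜ, ∑ b with I y b, ((#{x ∈ S | I x b} : ℤ) - 1) =
      ∑ b, ∑ y ∈ Sᶜ with I y b, ((#{x ∈ S | I x b} : ℤ) - 1) :=
    sum_comm' (by simp)
  rw [sum_congr rfl hy, sum_const, card_compl, hU.card_points, nsmul_eq_mul,
    Nat.cast_sub (by rw [← hU.card_points]; exact card_le_univ S)] at h
  push_cast at h
  rw [h]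
  refine sum_congr rfl fun b _ => ?_
  rw [sum_const, nsmul_eq_mul]
  congr 1
  have h1 := card_filter_add_card_filter_not (s := ({x | I x b} : Finset P)) (· ∈ S)
  rw [hU.card_row, filter_filter, filter_filter] at h1
  have h2 : ({x | I x b ∧ x ∈ S} : Finset P) = ({x ∈ S | I x b} : Finset P) := by ext; simp [and_comm]
  have h3 : ({x | I x b ∧ x ∉ S} : Finset P) = ({x ∈ Sᶜ | I x b} : Finset P) := by ext; simp [and_comm]
  rw [h2, h3] at h1
  lia

/-- Compares `sum_excess` with `sum_pairs` block by block. With `s` points of `S` on a block, `(q -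
1) * s * (s - 1)` exceeds `2 * (q + 1 - s) * (s - 1)` by `(q + 1) * (s - 1) * (s - 2)`, nonnegative
for integral `s`. Blocks of `C` have zero excess, so their pairs can be discarded. -/
theorem IsUnital.support_inequality (hU : IsUnital I q) (C : Finset B) (S : Finset P)
    (hS : ∀ b ∈ C, ∀ x, I x b → x ∈ S) :
    2 * (((q : ℤ) ^ 3 + 1 - #S) * (#S - q ^ 2)) ≤
      (q - 1) * (#S * (#S - 1) - #C * ((q + 1) * q)) := by
  have hq : (1 : ℤ) < q := by exact_mod_cast hU.one_lt
  have hfull : ∀ b ∈ C, #{x ∈ S | I x b} = q + 1 := by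
    intro b hb
    rw [← hU.card_row b]
    congr 1
    ext x
    simpa using hS b hb x
  have hC : ∑ b, (if b ∈ C then ((q : ℤ) + 1) * q else 0) = #C * ((q + 1) * q) := by
    rw [← sum_filter, filter_univ_mem, sum_const, nsmul_eq_mul]
  rw [← hU.sum_excess, ← hU.sum_pairs, ← hC, ← sum_sub_distrib, mul_sum, mul_sum]
  refine sum_le_sum fun b _ => ?_
  split_ifs with hb
  · rw [hfull b hb]
    push_cast
    nlinarith
  · generalize #{x ∈ S | I x b} = s
    rcases s with _ | _ | s
    · push_cast
      nlinarith
    · simp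
    · push_cast
      have : (0 : ℤ) ≤ (q + 1) * (s * (s + 1)) := by positivity
      nlinarith

theorem IsUnital.card_lt_of_no_common_point (hU : IsUnital I q) (hq : 2 < q) {C : Finset B}
    (hC : (confluenceGraph I).IsClique (C : Set B)) (hno : ∀ p, ∃ c ∈ C, ¬ I p c) :
    #C < q ^ 2 := by
  by_contra! hge
  obtain ⟨D, hDC, hD⟩ := exists_subset_card_eq hge
  have hDclique : (confluenceGraph I).IsClique (D : Set B) := hC.subset (by exact_mod_cast hDC)
  -- The block missing `z` is taken from the whole clique `C`, not from `D`.
  have hdeg (z : P) : #{b ∈ D | I z b} ≤ q + 1 := by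
    obtain ⟨c, hc, hz⟩ := hno z
    exact (card_le_card (filter_subset_filter _ hDC)).trans (hU.card_degree_le hC hc hz)
  have key := hU.support_inequality D {x | ∃ b ∈ D, I x b}
    fun b hb x hx => by simpa using ⟨b, hb, hx⟩
  rw [hD] at key
  have hq' : (3 : ℤ) ≤ q := by exact_mod_cast hq
  by_cases hz : ∃ z, #{b ∈ D | I z b} = q + 1
  · obtain ⟨z, hz⟩ := hz
    rw [hU.card_support_of_degree_eq hDclique hz] at key
    push_cast at key
    -- Left side minus right side of `key`; the last factor `q ^ 2 - 2 * q - 1` is negative for `q =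
    -- 2`.
    have h : (0 : ℤ) < q * (q + 1) * (q * (q - 3) + (q - 1)) := by
      have : (0 : ℤ) ≤ q * (q - 3) := mul_nonneg (by lia) (by lia)
      have : (0 : ℤ) < q * (q - 3) + (q - 1) := by lia
      positivity
    nlinarith
  · push Not at hz
    rw [hU.card_support_of_degree_le hDclique hD
      fun x => Nat.lt_succ_iff.1 (lt_of_le_of_ne (hdeg x) (hz x))] at key
    push_cast at key
    have h : (0 : ℤ) < (q + 1) * (q * (q - 1) * (q - 1)) := by
      have : (0 : ℤ) < q - 1 := by lia
      positivity
    nlinarith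

end

theorem theorem2p1 {P B : Type*} (I : P → B → Prop) (q : ℕ) (hq : 2 < q) (hU : IsUnital I q)
    (C : Set B) (hC : (confluenceGraph I).IsClique C) :
    C.encard ≤ (q : ℕ∞) ^ 2 ∧
      (C.encard = (q : ℕ∞) ^ 2 ↔ ∃ p : P, C = pencil I p) := by
  classical
  have := hU.finite_points
  have := hU.finite_blocks
  have := Fintype.ofFinite P
  have := Fintype.ofFinite B
  have hpencil (p : P) : (pencil I p).encard = (q : ℕ∞) ^ 2 := by
    have h := hU.card_pencil p
    rw [pencil, ← Finset.coe_filter_univ, Set.encard_coe_eq_coe_finsetCard]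
    exact_mod_cast congrArg (Nat.cast : ℕ → ℕ∞) (by convert h)
  have hpencil_of_eq : (∃ p : P, C = pencil I p) → C.encard = (q : ℕ∞) ^ 2 := by
    rintro ⟨p, rfl⟩
    exact hpencil p
  by_cases hno : ∃ p, ∀ c ∈ C, I p c
  · obtain ⟨p, hp⟩ := hno
    have hsub : C ⊆ pencil I p := hp
    refine ⟨hpencil p ▸ Set.encard_le_encard hsub, fun h => ⟨p, ?_⟩, hpencil_of_eq⟩
    exact (Set.toFinite _).eq_of_subset_of_encard_le hsub (by rw [h, hpencil])
  · push Not at hno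
    have hlt : C.encard < (q : ℕ∞) ^ 2 := by
      have h := hU.card_lt_of_no_common_point hq (C := C.toFinset) (by simpa using hC)
        (by simpa using hno)
      rw [Set.encard_eq_coe_toFinset_card]
      exact_mod_cast h
    exact ⟨hlt.le, fun h => absurd h hlt.ne, hpencil_of_eq⟩
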